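/- Let $\iota : N \to M$ be a homomorphism of unital rings, so that $M$ is an $N$-$N$-bimodule via $n\cdot m\cdot n' = \iota(n)\,m\,\iota(n')$. Suppose that the ring extension $M|N$ is left depth two: for some positive integer $n$, the $N$-$M$-bimodule $M\otimes_N M$ is isomorphic to a direct summand of the $N$-$M$-bimodule $M^n$. Put - $R = C_M(N) = \{r\in M : r\,\iota(n) = \iota(n)\,r \text{ for all } n\in N\}$, - $A = \mathrm{End}({}_NM_N)$, the $N$-$N$-bimodule endomorphisms of $M$, - $B = (M\otimes_N M)^N = \{b\in M\otimes_N M : nb = bn \text{ for all } n\in N\}$, - $C = \mathrm{End}({}_N(M\otimes_N M)_M)$, the $N$-$M$-bimodule endomorphisms of $M\otimes_N M$, a ring under composition. Write $b = b^1\otimes b^2$ for $b\in B$ (summation suppressed). For $\alpha\in A$ let $\hat\alpha : M\otimes_N M\to M$, $\hat\alpha(m\otimes m')=\alpha(m)m'$. Then $B$ is a $C$-$R$-bimodule by $c\cdot b\cdot r = c(b^1\otimes b^2 r)$, and $A$ is an $R$-$C$-bimodule by $(r\cdot\alpha\cdot c)(m) = r\,\hat\alpha(c(m\otimes 1))$.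 Then $C$ and $R$ are Morita equivalent rings (their categories of left modules are equivalent), and ${}_CB_R$ and ${}_RA_C$ are inverse invertible bimodules: the map $\mu_R$ of (1) below and the map $A\otimes_C B\to R$, $\alpha\otimes b\mapsto\alpha(b^1)b^2$, are bimodule isomorphisms which form a Morita context (that is, they satisfy the two associativity laws). In particular, $B_R$ and ${}_RA$ are finitely generated projective generators. Moreover, the following are well-defined isomorphisms: 1. $\mu_R : B\otimes_R A\to C$, $b\otimes\alpha\mapsto (m\otimes m'\mapsto b\,\alpha(m)m')$, of $C$-$C$-bimodules. 2. $\psi : B\to \mathrm{Hom}({}_RA,{}_RR)$, $b\mapsto(\alpha\mapsto\alpha(b^1)b^2)$, of $C$-$R$-bimodules, where $(c\cdot f\cdot r)(\alpha) = f(\alpha\cdot c)\,r$. 3. $\tau : B\otimes_R M\to M\otimes_N M$, $b\otimes m\mapsto bm$, of $C$-$M$-bimodules, which also satisfies $\tau(b\otimes nm) = n\,\tau(b\otimes m)$ for $n\in N$. 4. $M\otimes_N M\to \mathrm{Hom}({}_RA,{}_RM)$, $m\otimes m'\mapsto(\alpha\mapsto\alpha(m)m')$, compatible with the left $C$-, left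 $N$- and right $M$-actions, where $(c\cdot f)(\alpha) = f(\alpha\cdot c)$, $(n\cdot f)(\alpha)=\iota(n)f(\alpha)$ and $(f\cdot m)(\alpha)=f(\alpha)m$. 5. $C\to\mathrm{End}(B_R)$, $c\mapsto(b\mapsto c(b))$, of rings. 6. $C\to\mathrm{End}({}_RA)$, $c\mapsto(\alpha\mapsto\alpha\cdot c)$, of rings, where endomorphisms of the left module ${}_RA$ act from the right, so that the product $fg$ means "first $f$, then $g$". -/

import Mathlib

open MulOpposite
open scoped TensorProduct

universe u v

/-! ### Tensor products over a noncommutative ring -/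

section BalTensor

variable (S : Type*) (P : Type*) (Q : Type*) [Ring S]
  [AddCommGroup P] [Module Sᵐᵒᵖ P] [AddCommGroup Q] [Module S Q]

/-- The subgroup of `P ⊗[ℤ] Q` generated by the elements `(p · s) ⊗ q - p ⊗ (s · q)`. -/
def balancedRel : Submodule ℤ (P ⊗[ℤ] Q) :=
  Submodule.span ℤ {x | ∃ (p : P) (s : S) (q : Q), x = (op s • p) ⊗ₜ[ℤ] q - p ⊗ₜ[ℤ] (s • q)}

/-- The tensor product `P ⊗_S Q` of a right `S`-module `P` and a left `S`-module `Q`, for a not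
necessarily commutative ring `S`. Right modules are modules over the opposite ring. -/
def BalTensor : Type _ := (P ⊗[ℤ] Q) ⧸ balancedRel S P Q

noncomputable instance BalTensor.addCommGroup : AddCommGroup (BalTensor S P Q) :=
  inferInstanceAs (AddCommGroup ((P ⊗[ℤ] Q) ⧸ balancedRel S P Q))

namespace BalTensor

variable {P Q}

/-- The pure tensor `p ⊗ q` in `P ⊗_S Q`. -/
def tmul (p : P) (q : Q) : BalTensor S P Q :=
  (balancedRel S P Q).mkQ (p ⊗ₜ[ℤ] q)

theorem add_tmul (p p' : P) (q : Q) : tmul S (p + p') q = tmul S p q + tmul S p' q := by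
  unfold tmul
  rw [TensorProduct.add_tmul]
  exact map_add (balancedRel S P Q).mkQ _ _

theorem tmul_add (p : P) (q q' : Q) : tmul S p (q + q') = tmul S p q + tmul S p q' := by
  unfold tmul
  rw [TensorProduct.tmul_add]
  exact map_add (balancedRel S P Q).mkQ _ _

theorem zero_tmul (q : Q) : tmul S (0 : P) q = 0 := by
  unfold tmul
  rw [TensorProduct.zero_tmul]
  exact map_zero (balancedRel S P Q).mkQ

theorem tmul_zero (p : P) : tmul S p (0 : Q) = 0 := by
  unfold tmul
  rw [TensorProduct.tmul_zero]
  exact map_zero (balancedRel S P Q).mkQ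

theorem smul_tmul (p : P) (s : S) (q : Q) : tmul S (op s • p) q = tmul S p (s • q) :=
  (Submodule.Quotient.eq _).2 (Submodule.subset_span ⟨p, s, q, rfl⟩)

@[elab_as_elim]
theorem induction_on {motive : BalTensor S P Q → Prop} (x : BalTensor S P Q)
    (zero : motive 0) (tmul : ∀ p q, motive (tmul S p q))
    (add : ∀ x y, motive x → motive y → motive (x + y)) : motive x := by
  obtain ⟨y, rfl⟩ := Submodule.mkQ_surjective (balancedRel S P Q) x
  induction y using TensorProduct.induction_on with
  | zero => exact zero
  | tmul p q => exact tmul p q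
  | add a b ha hb => exact add _ _ ha hb

variable {S}

/-- The additive map out of `P ⊗_S Q` induced by an `S`-balanced biadditive map. -/
noncomputable def lift {G : Type*} [AddCommGroup G] (f : P →+ Q →+ G)
    (hf : ∀ p (s : S) q, f (op s • p) q = f p (s • q)) : BalTensor S P Q →+ G :=
  ((balancedRel S P Q).liftQ
    (TensorProduct.liftAddHom f (fun n p q => by simp)).toIntLinearMap (by
      refine Submodule.span_le.2 ?_
      rintro _ ⟨p, s, q, rfl⟩
      simp [hf])).toAddMonoidHom

@[simp]
theorem lift_tmul {G : Type*} [AddCommGroup G] (f : P →+ Q →+ G)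
    (hf : ∀ p (s : S) q, f (op s • p) q = f p (s • q)) (p : P) (q : Q) :
    lift f hf (tmul S p q) = f p q := rfl

theorem addHom_ext {G : Type*} [AddCommGroup G] {f g : BalTensor S P Q →+ G}
    (h : ∀ p q, f (tmul S p q) = g (tmul S p q)) : f = g := by
  ext x
  induction x using induction_on with
  | zero => simp
  | tmul p q => exact h p q
  | add x y hx hy => rw [map_add, map_add, hx, hy]

/-- The additive endomorphism `f ⊗ g` of `P ⊗_S Q`, for `S`-linear endomorphisms `f`, `g`. -/
noncomputable def mapEnd (f : Module.End Sᵐᵒᵖ P) (g : Module.End S Q) :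
    BalTensor S P Q →+ BalTensor S P Q :=
  lift (AddMonoidHom.mk' (fun p => AddMonoidHom.mk' (fun q => tmul S (f p) (g q))
      (fun q q' => by rw [map_add, tmul_add]))
      (fun p p' => by ext q; simp [add_tmul]))
    (fun p s q => by simp [smul_tmul])

theorem mapEnd_tmul (f : Module.End Sᵐᵒᵖ P) (g : Module.End S Q) (p : P) (q : Q) :
    mapEnd f g (tmul S p q) = tmul S (f p) (g q) := rfl

theorem mapEnd_one : mapEnd (1 : Module.End Sᵐᵒᵖ P) (1 : Module.End S Q) = AddMonoidHom.id _ :=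
  addHom_ext fun _ _ => rfl

/-- Endomorphisms of `P` act on `P ⊗_S Q` through the first factor. -/
noncomputable def leftHom : Module.End Sᵐᵒᵖ P →+* AddMonoid.End (BalTensor S P Q) where
  toFun f := mapEnd f 1
  map_one' := mapEnd_one
  map_mul' f g := addHom_ext (g := (mapEnd f 1).comp (mapEnd g 1)) fun _ _ => rfl
  map_zero' := addHom_ext (g := 0) fun _ q => zero_tmul S q
  map_add' f g := addHom_ext (g := mapEnd f 1 + mapEnd g 1) fun p q => add_tmul S (f p) (g p) q

/-- Endomorphisms of `Q` act on `P ⊗_S Q` through the second factor. -/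
noncomputable def rightHom : Module.End S Q →+* AddMonoid.End (BalTensor S P Q) where
  toFun g := mapEnd 1 g
  map_one' := mapEnd_one
  map_mul' f g := addHom_ext (g := (mapEnd 1 f).comp (mapEnd 1 g)) fun _ _ => rfl
  map_zero' := addHom_ext (g := 0) fun p _ => tmul_zero S p
  map_add' f g := addHom_ext (g := mapEnd 1 f + mapEnd 1 g) fun p q => tmul_add S p (f q) (g q)

/-- If `P` is an `L`-`S`-bimodule then `P ⊗_S Q` is a left `L`-module. -/
noncomputable instance leftModule {L : Type*} [Ring L] [Module L P] [SMulCommClass L Sᵐᵒᵖ P] :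
    Module L (BalTensor S P Q) :=
  Module.compHom (BalTensor S P Q)
    ((leftHom (S := S) (P := P) (Q := Q)).comp (Module.toModuleEnd Sᵐᵒᵖ (S := L) P))

/-- If `Q` is an `S`-`K`-bimodule then `P ⊗_S Q` is a right `K`-module. -/
noncomputable instance rightModule {K : Type*} [Ring K] [Module Kᵐᵒᵖ Q] [SMulCommClass S Kᵐᵒᵖ Q] :
    Module Kᵐᵒᵖ (BalTensor S P Q) :=
  haveI : SMulCommClass Kᵐᵒᵖ S Q := SMulCommClass.symm _ _ _
  Module.compHom (BalTensor S P Q)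
    ((rightHom (S := S) (P := P) (Q := Q)).comp (Module.toModuleEnd S (S := Kᵐᵒᵖ) Q))

theorem left_smul_tmul {L : Type*} [Ring L] [Module L P] [SMulCommClass L Sᵐᵒᵖ P]
    (l : L) (p : P) (q : Q) : l • tmul S p q = tmul S (l • p) q := rfl

theorem right_smul_tmul {K : Type*} [Ring K] [Module Kᵐᵒᵖ Q] [SMulCommClass S Kᵐᵒᵖ Q]
    (k : K) (p : P) (q : Q) : op k • tmul S p q = tmul S p (op k • q) := rfl

end BalTensor

end BalTensor

/-! ### Morita contexts -/

/-- A Morita context between rings `U` and `T`: a `U`-`T`-bimodule `P`, a `T`-`U`-bimodule `Q`,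
bimodule maps `P ⊗_T Q → U` and `Q ⊗_U P → T`, and the two associativity laws. -/
structure MoritaContext (U T P Q : Type*) [Ring U] [Ring T] [AddCommGroup P] [AddCommGroup Q]
    [Module U P] [Module Tᵐᵒᵖ P] [SMulCommClass U Tᵐᵒᵖ P]
    [Module T Q] [Module Uᵐᵒᵖ Q] [SMulCommClass T Uᵐᵒᵖ Q] where
  pq : BalTensor T P Q →+ U
  qp : BalTensor U Q P →+ T
  pq_left : ∀ (a : U) (x : BalTensor T P Q), pq (a • x) = a * pq x
  pq_right : ∀ (a : U) (x : BalTensor T P Q), pq (op a • x) = pq x * a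
  qp_left : ∀ (r : T) (x : BalTensor U Q P), qp (r • x) = r * qp x
  qp_right : ∀ (r : T) (x : BalTensor U Q P), qp (op r • x) = qp x * r
  assoc_left : ∀ (p : P) (q : Q) (p' : P),
    pq (BalTensor.tmul T p q) • p' = op (qp (BalTensor.tmul U q p')) • p
  assoc_right : ∀ (q : Q) (p : P) (q' : Q),
    qp (BalTensor.tmul U q p) • q' = op (pq (BalTensor.tmul T p q')) • q

/-- A left module is f.g. projective and a generator of the module category. (For right modules,
use the opposite ring.) -/
def IsFGProjGenerator (T : Type u) [Ring T] (P : Type u) [AddCommGroup P] [Module T P] : Prop :=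
  Module.Finite T P ∧ Module.Projective T P ∧ CategoryTheory.IsSeparator (ModuleCat.of T P)

/-! ### The centralizers of a ring extension -/

namespace RingExt

variable {N : Type v} {M : Type u} [Ring N] [Ring M] (ι : N →+* M)

/-- The tensor square `M ⊗_N M` of the ring extension `ι : N → M`, where `N` acts on both sides
of `M` through `ι`. -/
def TensorSq : Type u :=
  letI : Module N M := Module.compHom M ι
  letI : Module Nᵐᵒᵖ M := Module.compHom M ι.op
  BalTensor N M M

noncomputable instance : AddCommGroup (TensorSq ι) :=
  letI : Module N M := Module.compHom M ι
  letI : Module Nᵐᵒᵖ M := Module.compHom M ι.op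
  BalTensor.addCommGroup N M M

/-- The left `N`-module structure `n · (x ⊗ y) = ι n x ⊗ y`. -/
noncomputable instance : Module N (TensorSq ι) :=
  letI : Module N M := Module.compHom M ι
  letI : Module Nᵐᵒᵖ M := Module.compHom M ι.op
  haveI : SMulCommClass N Nᵐᵒᵖ M := ⟨fun a b m => (mul_assoc (ι a) m (ι b.unop)).symm⟩
  BalTensor.leftModule (S := N) (P := M) (Q := M) (L := N)

/-- The right `M`-module structure `(x ⊗ y) · m = x ⊗ y m`. -/
noncomputable instance : Module Mᵐᵒᵖ (TensorSq ι) :=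
  letI : Module N M := Module.compHom M ι
  letI : Module Nᵐᵒᵖ M := Module.compHom M ι.op
  haveI : SMulCommClass N Mᵐᵒᵖ M := ⟨fun a b m => (mul_assoc (ι a) m b.unop).symm⟩
  BalTensor.rightModule (S := N) (P := M) (Q := M) (K := M)

/-- The pure tensor `x ⊗ y` in `M ⊗_N M`. -/
def tmul (x y : M) : TensorSq ι :=
  letI : Module N M := Module.compHom M ι
  letI : Module Nᵐᵒᵖ M := Module.compHom M ι.op
  BalTensor.tmul N x y

theorem add_tmul (x x' y : M) : tmul ι (x + x') y = tmul ι x y + tmul ι x' y :=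
  letI : Module N M := Module.compHom M ι
  letI : Module Nᵐᵒᵖ M := Module.compHom M ι.op
  BalTensor.add_tmul N x x' y

theorem tmul_add (x y y' : M) : tmul ι x (y + y') = tmul ι x y + tmul ι x y' :=
  letI : Module N M := Module.compHom M ι
  letI : Module Nᵐᵒᵖ M := Module.compHom M ι.op
  BalTensor.tmul_add N x y y'

theorem mul_tmul (x : M) (n : N) (y : M) : tmul ι (x * ι n) y = tmul ι x (ι n * y) :=
  letI : Module N M := Module.compHom M ι
  letI : Module Nᵐᵒᵖ M := Module.compHom M ι.op
  BalTensor.smul_tmul N x n y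

theorem smul_tmul (n : N) (x y : M) : n • tmul ι x y = tmul ι (ι n * x) y := rfl

theorem op_smul_tmul (m x y : M) : op m • tmul ι x y = tmul ι x (y * m) := rfl

variable {ι} in
@[elab_as_elim]
theorem induction_on {motive : TensorSq ι → Prop} (t : TensorSq ι)
    (zero : motive 0) (tmul : ∀ x y, motive (tmul ι x y))
    (add : ∀ s t, motive s → motive t → motive (s + t)) : motive t :=
  letI : Module N M := Module.compHom M ι
  letI : Module Nᵐᵒᵖ M := Module.compHom M ι.op
  BalTensor.induction_on (S := N) (P := M) (Q := M) t zero tmul add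

instance : SMulCommClass N Mᵐᵒᵖ (TensorSq ι) where
  smul_comm n m t := by
    induction t using induction_on with
    | zero => simp
    | tmul x y => rfl
    | add s t hs ht => simp only [smul_add, hs, ht]

/-- Left depth two: `M ⊗_N M ⊕ * ≅ Mⁿ` as `N`-`M`-bimodules for some positive `n`; here `X` is the
complementary `N`-`M`-bimodule. -/
def IsLeftD2 : Prop :=
  ∃ n : ℕ, 0 < n ∧
  ∃ (X : Type u) (_ : AddCommGroup X) (_ : Module N X) (_ : Module Mᵐᵒᵖ X)
    (_ : SMulCommClass N Mᵐᵒᵖ X) (e : (TensorSq ι × X) ≃+ (Fin n → M)),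
    (∀ (k : N) t i, e (k • t) i = ι k * e t i) ∧
    (∀ (m : M) t i, e (op m • t) i = e t i * m)

/-- `R = C_M(N)`, the centralizer of the image of `N` in `M`. -/
def R : Subring M := Subring.centralizer (Set.range ι)

/-- `A = End (N M N)`, the ring of `N`-`N`-bimodule endomorphisms of `M`. -/
def A : Subring (AddMonoid.End M) where
  carrier := {f | ∀ n m, f (ι n * m) = ι n * f m ∧ f (m * ι n) = f m * ι n}
  mul_mem' {f g} hf hg n m := by
    change f (g (ι n * m)) = ι n * f (g m) ∧ f (g (m * ι n)) = f (g m) * ι n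
    rw [(hg n m).1, (hg n m).2, (hf n (g m)).1, (hf n (g m)).2]
    exact ⟨rfl, rfl⟩
  one_mem' _ _ := ⟨rfl, rfl⟩
  add_mem' {f g} hf hg n m := by
    change f (ι n * m) + g (ι n * m) = ι n * (f m + g m) ∧
      f (m * ι n) + g (m * ι n) = (f m + g m) * ι n
    rw [(hg n m).1, (hg n m).2, (hf n m).1, (hf n m).2, mul_add, add_mul]
    exact ⟨rfl, rfl⟩
  zero_mem' n _ := ⟨(mul_zero (ι n)).symm, (zero_mul (ι n)).symm⟩
  neg_mem' {f} hf n m := by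
    change -f (ι n * m) = ι n * -f m ∧ -f (m * ι n) = -f m * ι n
    rw [(hf n m).1, (hf n m).2, mul_neg, neg_mul]
    exact ⟨rfl, rfl⟩

/-- `B = (M ⊗_N M)^N`. -/
def B : AddSubgroup (TensorSq ι) where
  carrier := {t | ∀ n : N, n • t = op (ι n) • t}
  add_mem' {s t} hs ht n := by rw [smul_add, smul_add, hs n, ht n]
  zero_mem' n := by simp
  neg_mem' {t} ht n := by rw [smul_neg, smul_neg, ht n]

/-- `C = End (N (M ⊗_N M) M)`, the ring of `N`-`M`-bimodule endomorphisms of `M ⊗_N M`. -/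
def C : Subring (AddMonoid.End (TensorSq ι)) where
  carrier := {c | (∀ (n : N) t, c (n • t) = n • c t) ∧ ∀ (m : M) t, c (op m • t) = op m • c t}
  mul_mem' {f g} hf hg :=
    ⟨fun n t => (congrArg f (hg.1 n t)).trans (hf.1 n (g t)),
      fun m t => (congrArg f (hg.2 m t)).trans (hf.2 m (g t))⟩
  one_mem' := ⟨fun _ _ => rfl, fun _ _ => rfl⟩
  add_mem' {f g} hf hg :=
    ⟨fun n t => (congrArg₂ (· + ·) (hf.1 n t) (hg.1 n t)).trans (smul_add n (f t) (g t)).symm,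
      fun m t =>
        (congrArg₂ (· + ·) (hf.2 m t) (hg.2 m t)).trans (smul_add (op m) (f t) (g t)).symm⟩
  zero_mem' := ⟨fun n _ => (smul_zero n).symm, fun m _ => (smul_zero (op m)).symm⟩
  neg_mem' {f} hf :=
    ⟨fun n t => (congrArg Neg.neg (hf.1 n t)).trans (smul_neg n (f t)).symm,
      fun m t => (congrArg Neg.neg (hf.2 m t)).trans (smul_neg (op m) (f t)).symm⟩

variable {ι}

theorem R_comm (r : R ι) (n : N) : ι n * (r : M) = r * ι n :=
  Subring.mem_centralizer_iff.1 r.2 _ ⟨n, rfl⟩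

/-- The left `C`-module structure `c · b = c(b)` on `B`. -/
noncomputable instance : Module (C ι) (B ι) where
  smul c b := ⟨c.1 b.1, fun n => by rw [← c.2.1, b.2 n, c.2.2]⟩
  one_smul b := rfl
  mul_smul c d b := rfl
  smul_zero c := Subtype.ext (map_zero c.1)
  smul_add c b b' := Subtype.ext (map_add c.1 b.1 b'.1)
  add_smul c d b := rfl
  zero_smul b := rfl

/-- The right `R`-module structure `b · r = b¹ ⊗ b² r` on `B`. -/
noncomputable instance : Module (R ι)ᵐᵒᵖ (B ι) where
  smul r b := ⟨op (r.unop : M) • b.1, fun n => by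
    rw [smul_comm, b.2 n, smul_smul, smul_smul, ← op_mul, ← op_mul, R_comm]⟩
  one_smul b := Subtype.ext (one_smul Mᵐᵒᵖ b.1)
  mul_smul r s b := Subtype.ext (mul_smul (op (r.unop : M)) (op (s.unop : M)) b.1)
  smul_zero r := Subtype.ext (smul_zero (op (r.unop : M)))
  smul_add r b b' := Subtype.ext (smul_add (op (r.unop : M)) b.1 b'.1)
  add_smul r s b := Subtype.ext (add_smul (op (r.unop : M)) (op (s.unop : M)) b.1)
  zero_smul b := Subtype.ext (zero_smul Mᵐᵒᵖ b.1)

instance : SMulCommClass (C ι) (R ι)ᵐᵒᵖ (B ι) where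
  smul_comm c r b := Subtype.ext (c.2.2 (r.unop : M) b.1)

/-- The additive map `M ⊗_N M → M`, `m ⊗ m' ↦ α(m) m'`, that is `μ ∘ (α ⊗ id)`. -/
noncomputable def evalHom (α : A ι) : TensorSq ι →+ M :=
  letI : Module N M := Module.compHom M ι
  letI : Module Nᵐᵒᵖ M := Module.compHom M ι.op
  BalTensor.lift (S := N) (P := M) (Q := M) (AddMonoidHom.mul.comp α.1) (fun p s q => by
    change α.1 (p * ι s) * q = α.1 p * (ι s * q)
    rw [(α.2 s p).2, mul_assoc])

theorem evalHom_tmul (α : A ι) (x y : M) : evalHom α (tmul ι x y) = α.1 x * y := rfl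

theorem evalHom_smul (α : A ι) (n : N) (t : TensorSq ι) :
    evalHom α (n • t) = ι n * evalHom α t := by
  induction t using induction_on with
  | zero => simp
  | tmul x y => rw [smul_tmul, evalHom_tmul, evalHom_tmul, (α.2 n x).1, mul_assoc]
  | add s t hs ht => rw [smul_add, map_add, map_add, hs, ht, mul_add]

theorem evalHom_op_smul (α : A ι) (m : M) (t : TensorSq ι) :
    evalHom α (op m • t) = evalHom α t * m := by
  induction t using induction_on with
  | zero => simp
  | tmul x y => rw [op_smul_tmul, evalHom_tmul, evalHom_tmul, mul_assoc]
  | add s t hs ht => rw [smul_add, map_add, map_add, hs, ht, add_mul]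

theorem tmul_one_smul (n : N) (m : M) : tmul ι (ι n * m) 1 = n • tmul ι m 1 := rfl

theorem tmul_one_op_smul (n : N) (m : M) : tmul ι (m * ι n) 1 = op (ι n) • tmul ι m 1 := by
  rw [mul_tmul, op_smul_tmul, one_mul, mul_one]

/-- The left `R`-module structure `r · α = λ(r) ∘ α` on `A`. -/
instance : Module (R ι) (A ι) where
  smul r α := ⟨(AddMonoidHom.mulLeft (r : M)).comp α.1, fun n m => by
    change (r : M) * α.1 (ι n * m) = ι n * (r * α.1 m) ∧ (r : M) * α.1 (m * ι n) = r * α.1 m * ι n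
    rw [(α.2 n m).1, (α.2 n m).2]
    rw [← mul_assoc, ← mul_assoc, ← mul_assoc, R_comm]
    exact ⟨rfl, rfl⟩⟩
  one_smul α := Subtype.ext (AddMonoidHom.ext fun m => one_mul (α.1 m))
  mul_smul r s α := Subtype.ext (AddMonoidHom.ext fun m => mul_assoc (r : M) s (α.1 m))
  smul_zero r := Subtype.ext (AddMonoidHom.ext fun _ => mul_zero (r : M))
  smul_add r α β := Subtype.ext (AddMonoidHom.ext fun m => mul_add (r : M) (α.1 m) (β.1 m))
  add_smul r s α := Subtype.ext (AddMonoidHom.ext fun m => add_mul (r : M) s (α.1 m))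
  zero_smul α := Subtype.ext (AddMonoidHom.ext fun m => zero_mul (α.1 m))

/-- `α · c = μ (α ⊗ id) c ι₁`, that is, the map `m ↦ (μ (α ⊗ id)) (c (m ⊗ 1))`. -/
noncomputable def actC (α : A ι) (c : C ι) : A ι :=
  ⟨AddMonoidHom.mk' (fun m => evalHom α (c.1 (tmul ι m 1)))
      (fun m m' => by rw [add_tmul, map_add, map_add]), fun n m => by
    change evalHom α (c.1 (tmul ι (ι n * m) 1)) = ι n * evalHom α (c.1 (tmul ι m 1)) ∧
      evalHom α (c.1 (tmul ι (m * ι n) 1)) = evalHom α (c.1 (tmul ι m 1)) * ι n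
    rw [tmul_one_smul, tmul_one_op_smul, c.2.1, c.2.2, evalHom_smul, evalHom_op_smul]
    exact ⟨rfl, rfl⟩⟩

theorem actC_apply (α : A ι) (c : C ι) (m : M) :
    (actC α c).1 m = evalHom α (c.1 (tmul ι m 1)) := rfl

theorem evalHom_actC (α : A ι) (c : C ι) (t : TensorSq ι) :
    evalHom (actC α c) t = evalHom α (c.1 t) := by
  induction t using induction_on with
  | zero => simp
  | tmul x y =>
    rw [evalHom_tmul, actC_apply, ← evalHom_op_smul, ← c.2.2, op_smul_tmul, one_mul]
  | add s t hs ht => rw [map_add, map_add, map_add, hs, ht]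

theorem evalHom_add (α β : A ι) (t : TensorSq ι) :
    evalHom (α + β) t = evalHom α t + evalHom β t := by
  induction t using induction_on with
  | zero => simp
  | tmul x y => exact add_mul (α.1 x) (β.1 x) y
  | add s t hs ht => rw [map_add, map_add, map_add, hs, ht]; abel

theorem evalHom_zero (t : TensorSq ι) : evalHom (0 : A ι) t = 0 := by
  have h := evalHom_add (0 : A ι) 0 t
  rw [add_zero] at h
  exact left_eq_add.1 h

theorem evalHom_rsmul (r : R ι) (α : A ι) (t : TensorSq ι) :
    evalHom (r • α) t = r * evalHom α t := by
  induction t using induction_on with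
  | zero => simp
  | tmul x y => exact mul_assoc (r : M) (α.1 x) y
  | add s t hs ht => rw [map_add, map_add, hs, ht, mul_add]

/-- The right `C`-module structure `α · c = μ (α ⊗ id) c ι₁` on `A`. -/
noncomputable instance : Module (C ι)ᵐᵒᵖ (A ι) where
  smul c α := actC α c.unop
  one_smul α := Subtype.ext (AddMonoidHom.ext fun m => mul_one (α.1 m))
  mul_smul c d α := Subtype.ext (AddMonoidHom.ext fun m =>
    (evalHom_actC α d.unop (c.unop.1 (tmul ι m 1))).symm)
  smul_zero c := Subtype.ext (AddMonoidHom.ext fun m => evalHom_zero (c.unop.1 (tmul ι m 1)))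
  smul_add _ α β := Subtype.ext (AddMonoidHom.ext fun _ => evalHom_add α β _)
  add_smul _ _ α := Subtype.ext (AddMonoidHom.ext fun _ => map_add (evalHom α) _ _)
  zero_smul α := Subtype.ext (AddMonoidHom.ext fun _ => map_zero (evalHom α))

theorem op_smul_A_apply (α : A ι) (c : C ι) (m : M) :
    (op c • α).1 m = evalHom α (c.1 (tmul ι m 1)) := rfl

instance : SMulCommClass (R ι) (C ι)ᵐᵒᵖ (A ι) where
  smul_comm r _ α := Subtype.ext (AddMonoidHom.ext fun _ => (evalHom_rsmul r α _).symm)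

end RingExt

/-! Write `α̂` for `evalHom α`. The assignment `α ↦ α̂` identifies `A` with the `N`-`M`-bimodule
maps `M ⊗_N M → M`, since `α(m) = α̂(m ⊗ 1)`; dually, elements of `B` are the images of `1` under
bimodule maps `M → M ⊗_N M`. Composing one of each kind in the two possible orders gives the pairing
`α̂(b) ∈ R` (`pair`) and the endomorphism `t ↦ b α̂(t)` in `C` (`rankOne`). These form a Morita
context for every ring extension.

The map onto `R` always hits `1`, because the identity of `M` pairs with `1 ⊗ 1` to `1`. Left depth
two says that the identity of `M ⊗_N M` factors through some `Mⁿ`. In coordinates this is a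
quasibasis: `t = ∑ bᵢ β̂ᵢ(t)`, so the map onto `C` hits `1` as well (`IsLeftD2.exists_quasibasis`,
`exists_pq_eq_one`). A Morita context whose two maps hit `1` has both maps bijective and induces an
equivalence of module categories (`pq_bijective`, `eval_bijective`).

The remaining isomorphisms use the quasibasis as a dual basis: it expands elements of `B_R`
(`sum_B`), of `_R A` (`sum_A`) and of `M ⊗_N M`, which gives explicit inverses or preimages. -/

open CategoryTheory in
/-- Additive functors are linear for any `ℤ`-linear structures. -/
theorem CategoryTheory.Functor.linear_of_additive {D E : Type*} [Category* D] [Category* E]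
    [Preadditive D] [Preadditive E] (F : D ⥤ E) [F.Additive] (_ : CategoryTheory.Linear ℤ D)
    (_ : CategoryTheory.Linear ℤ E) :
    F.Linear ℤ where
  map_smul f r :=
    -- An abelian group has only one `ℤ`-module structure, so both scalar actions, however they are
    -- given, are integer multiples.
    (congrArg F.map (int_smul_eq_zsmul _ r f)).trans
      (F.map_zsmul.trans (int_smul_eq_zsmul _ r (F.map f)).symm)

/-! ### Functoriality of the balanced tensor product -/

namespace BalTensor

variable {S P Q : Type*} [Ring S] [AddCommGroup P] [Module Sᵐᵒᵖ P] [AddCommGroup Q] [Module S Q]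

/-- The additive map out of `P ⊗_S Q` induced by a function of two variables that is biadditive
and `S`-balanced. -/
noncomputable def liftFun {G : Type*} [AddCommGroup G] (f : P → Q → G)
    (add_left : ∀ p p' q, f (p + p') q = f p q + f p' q)
    (add_right : ∀ p q q', f p (q + q') = f p q + f p q')
    (balanced : ∀ p (s : S) q, f (op s • p) q = f p (s • q)) : BalTensor S P Q →+ G :=
  lift (S := S) (AddMonoidHom.mk' (fun p => AddMonoidHom.mk' (f p) (add_right p))
    (fun p p' => AddMonoidHom.ext (add_left p p'))) balanced

@[simp]
theorem liftFun_tmul {G : Type*} [AddCommGroup G] (f : P → Q → G)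
    (add_left : ∀ p p' q, f (p + p') q = f p q + f p' q)
    (add_right : ∀ p q q', f p (q + q') = f p q + f p q')
    (balanced : ∀ p (s : S) q, f (op s • p) q = f p (s • q)) (p : P) (q : Q) :
    liftFun f add_left add_right balanced (tmul S p q) = f p q := rfl

/-- The `L`-linear map `P ⊗_S Q → P ⊗_S Q'` induced by an `S`-linear map `Q → Q'`. -/
noncomputable def mapRight (P : Type*) [AddCommGroup P] [Module Sᵐᵒᵖ P]
    (L : Type*) [Ring L] [Module L P] [SMulCommClass L Sᵐᵒᵖ P]
    {Q' : Type*} [AddCommGroup Q'] [Module S Q'] (g : Q →ₗ[S] Q') :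
    BalTensor S P Q →ₗ[L] BalTensor S P Q' where
  __ := liftFun (S := S) (fun p q => tmul S p (g q)) (fun p p' q => add_tmul S p p' (g q))
    (fun p q q' => by rw [map_add, tmul_add]) (fun p s q => by rw [map_smul, smul_tmul])
  map_smul' l x := by
    induction x using induction_on with
    | zero => simp
    | tmul p q => rfl
    | add x y hx hy => simp_all [smul_add]

theorem linearMap_ext {L : Type*} [Ring L] [Module L P] [SMulCommClass L Sᵐᵒᵖ P]
    {G : Type*} [AddCommGroup G] [Module L G] {f g : BalTensor S P Q →ₗ[L] G}
    (h : ∀ p q, f (tmul S p q) = g (tmul S p q)) : f = g :=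
  LinearMap.toAddMonoidHom_injective (addHom_ext h)

/-- The `L`-linear map `P → P ⊗_S Q`, `p ↦ p ⊗ q`. -/
noncomputable def tmulRight (P : Type*) [AddCommGroup P] [Module Sᵐᵒᵖ P]
    (L : Type*) [Ring L] [Module L P] [SMulCommClass L Sᵐᵒᵖ P] (q : Q) :
    P →ₗ[L] BalTensor S P Q where
  toFun p := tmul S p q
  map_add' p p' := add_tmul S p p' q
  map_smul' _ _ := rfl

/-- The functor `P ⊗_S -` from left `S`-modules to left `L`-modules. -/
noncomputable def functor (S L P : Type u) [Ring S] [Ring L] [AddCommGroup P] [Module Sᵐᵒᵖ P]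
    [Module L P] [SMulCommClass L Sᵐᵒᵖ P] :
    CategoryTheory.Functor (ModuleCat.{u} S) (ModuleCat.{u} L) where
  obj X := ModuleCat.of L (BalTensor S P X)
  map f := ModuleCat.ofHom (mapRight P L f.hom)
  map_id _ := ModuleCat.hom_ext (linearMap_ext fun _ _ => rfl)
  map_comp _ _ := ModuleCat.hom_ext (linearMap_ext fun _ _ => rfl)

instance functor_additive (S L P : Type u) [Ring S] [Ring L] [AddCommGroup P] [Module Sᵐᵒᵖ P]
    [Module L P] [SMulCommClass L Sᵐᵒᵖ P] : (functor S L P).Additive where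
  map_add := ModuleCat.hom_ext (linearMap_ext fun p _ => tmul_add S p _ _)

end BalTensor

/-! ### Morita contexts whose maps hit `1` -/

namespace MoritaContext

open BalTensor

section

variable {U T P Q : Type*} [Ring U] [Ring T] [AddCommGroup P] [AddCommGroup Q]
  [Module U P] [Module Tᵐᵒᵖ P] [SMulCommClass U Tᵐᵒᵖ P]
  [Module T Q] [Module Uᵐᵒᵖ Q] [SMulCommClass T Uᵐᵒᵖ Q]
  (mc : MoritaContext U T P Q)

/-- The Morita context with the roles of the two rings exchanged. -/
def symm : MoritaContext T U Q P where
  pq := mc.qp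
  qp := mc.pq
  pq_left := mc.qp_left
  pq_right := mc.qp_right
  qp_left := mc.pq_left
  qp_right := mc.pq_right
  assoc_left := mc.assoc_right
  assoc_right := mc.assoc_left

/-- On pure tensors both associativity laws are used: `(pq)p' ⊗ q' = p(qp') ⊗ q' = p ⊗ (qp')q' = p ⊗
q(p'q')`. This exchange rule makes injectivity a consequence of surjectivity. -/
theorem pq_smul (x y : BalTensor T P Q) : mc.pq x • y = op (mc.pq y) • x := by
  induction x using BalTensor.induction_on with
  | zero => simp
  | add x x' hx hx' => rw [map_add, add_smul, hx, hx', smul_add]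
  | tmul p q =>
    induction y using BalTensor.induction_on with
    | zero => simp
    | add y y' hy hy' => rw [map_add, op_add, add_smul, smul_add, hy, hy']
    | tmul p' q' =>
      rw [left_smul_tmul, mc.assoc_left, BalTensor.smul_tmul, mc.assoc_right, right_smul_tmul]

/-- If `y` maps to `1` and `x` to `0`, then `x = x · pq(y) = pq(x) · y = 0`. -/
theorem pq_bijective (h : Function.Surjective mc.pq) : Function.Bijective mc.pq := by
  refine ⟨(injective_iff_map_eq_zero _).2 fun x hx => ?_, h⟩
  obtain ⟨y, hy⟩ := h 1
  have := mc.pq_smul x y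
  rwa [hx, hy, zero_smul, op_one, one_smul, eq_comm] at this

theorem pq_surjective (h : ∃ x, mc.pq x = 1) : Function.Surjective mc.pq := by
  obtain ⟨x, hx⟩ := h
  exact fun a => ⟨a • x, by rw [mc.pq_left, hx, mul_one]⟩

variable (X : Type*) [AddCommGroup X] [Module T X]

/-- The additive map `P ⊗_T X → X`, `p ⊗ x ↦ (q p) x`. -/
noncomputable def evalLeft (q : Q) : BalTensor T P X →+ X :=
  liftFun (fun p x => mc.qp (tmul U q p) • x) (fun p p' x => by rw [tmul_add, map_add, add_smul])
    (fun _ _ _ => smul_add _ _ _) (fun p t x => by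
      rw [← right_smul_tmul, mc.qp_right, mul_smul])

theorem evalLeft_tmul (q : Q) (p : P) (x : X) :
    mc.evalLeft X q (tmul T p x) = mc.qp (tmul U q p) • x := rfl

theorem evalLeft_add (q q' : Q) (y : BalTensor T P X) :
    mc.evalLeft X (q + q') y = mc.evalLeft X q y + mc.evalLeft X q' y := by
  induction y using BalTensor.induction_on with
  | zero => simp
  | add y y' hy hy' => rw [map_add, map_add, map_add, hy, hy', add_add_add_comm]
  | tmul p x => rw [evalLeft_tmul, BalTensor.add_tmul, map_add, add_smul]; rfl

theorem evalLeft_op_smul (q : Q) (a : U) (y : BalTensor T P X) :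
    mc.evalLeft X (op a • q) y = mc.evalLeft X q (a • y) := by
  induction y using BalTensor.induction_on with
  | zero => simp
  | add y y' hy hy' => rw [map_add, smul_add, map_add, hy, hy']
  | tmul p x => rw [evalLeft_tmul, left_smul_tmul, evalLeft_tmul, BalTensor.smul_tmul]

theorem evalLeft_smul (t : T) (q : Q) (y : BalTensor T P X) :
    mc.evalLeft X (t • q) y = t • mc.evalLeft X q y := by
  induction y using BalTensor.induction_on with
  | zero => simp
  | add y y' hy hy' => rw [map_add, map_add, smul_add, hy, hy']
  | tmul p x => rw [evalLeft_tmul, evalLeft_tmul, ← left_smul_tmul, mc.qp_left, mul_smul]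

/-- The `T`-linear map `Q ⊗_U (P ⊗_T X) → X`, `q ⊗ (p ⊗ x) ↦ (q p) x`. -/
noncomputable def eval : BalTensor U Q (BalTensor T P X) →ₗ[T] X where
  __ := liftFun (mc.evalLeft X · ·) (mc.evalLeft_add X) (fun _ _ _ => map_add _ _ _)
    (mc.evalLeft_op_smul X)
  map_smul' t w := by
    induction w using BalTensor.induction_on with
    | zero => simp
    | add w w' hw hw' => simp_all [smul_add]
    | tmul q y => exact mc.evalLeft_smul X t q y

theorem eval_tmul (q : Q) (p : P) (x : X) :
    mc.eval X (tmul U q (tmul T p x)) = mc.qp (tmul U q p) • x := rfl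

variable {X}

theorem eval_mapRight (x : X) (z : BalTensor U Q P) :
    mc.eval X (mapRight Q T (tmulRight P U x) z) = mc.qp z • x := by
  induction z using BalTensor.induction_on with
  | zero => simp
  | add z z' hz hz' => rw [map_add, map_add, map_add, hz, hz', add_smul]
  | tmul q p => rfl

/-- Together with `eval_mapRight`: evaluating and inserting `z` compose, in either order, to
multiplication by `qp z`. Hence a `z` with `qp z = 1` provides an inverse of `eval`. -/
theorem mapRight_eval (w : BalTensor U Q (BalTensor T P X)) (z : BalTensor U Q P) :
    mapRight Q T (tmulRight P U (mc.eval X w)) z = mc.qp z • w := by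
  induction z using BalTensor.induction_on with
  | zero => simp
  | add z z' hz hz' => rw [map_add, map_add, hz, hz', add_smul]
  | tmul q p =>
    change tmul U q (tmul T p (mc.eval X w)) = _
    induction w using BalTensor.induction_on with
    | zero => rw [map_zero, tmul_zero, tmul_zero, smul_zero]
    | add w w' hw hw' => rw [map_add, tmul_add, tmul_add, smul_add, hw, hw']
    | tmul q' y =>
      induction y using BalTensor.induction_on with
      | zero => simp [tmul_zero]
      | add y y' hy hy' => rw [tmul_add, map_add, tmul_add, tmul_add, smul_add, hy, hy']
      | tmul p' x =>
        -- The chain is `q ⊗ (p ⊗ (q'p')x) = q ⊗ (p(q'p') ⊗ x) = q ⊗ (pq')(p' ⊗ x) = q(pq') ⊗ (p' ⊗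
        -- x) = (qp)q' ⊗ (p' ⊗ x)`.
        rw [eval_tmul, ← BalTensor.smul_tmul, ← mc.assoc_left, ← left_smul_tmul,
          ← BalTensor.smul_tmul, ← mc.assoc_right, left_smul_tmul]

theorem eval_bijective (h : ∃ z, mc.qp z = 1) : Function.Bijective (mc.eval X) := by
  obtain ⟨z, hz⟩ := h
  refine ⟨(injective_iff_map_eq_zero _).2 fun w hw => ?_, fun x =>
    ⟨mapRight Q T (tmulRight P U x) z, by rw [eval_mapRight, hz, one_smul]⟩⟩
  have h0 : tmulRight (S := T) P U (0 : X) = 0 := LinearMap.ext fun p => tmul_zero T p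
  have h1 : mapRight Q T (0 : P →ₗ[U] BalTensor T P X) = 0 :=
    linearMap_ext fun q p => tmul_zero U q
  have := mc.mapRight_eval w z
  rwa [hw, h0, h1, hz, one_smul, LinearMap.zero_apply, eq_comm] at this

end

section

open CategoryTheory

variable {U T P Q : Type u} [Ring U] [Ring T] [AddCommGroup P] [AddCommGroup Q]
  [Module U P] [Module Tᵐᵒᵖ P] [SMulCommClass U Tᵐᵒᵖ P]
  [Module T Q] [Module Uᵐᵒᵖ Q] [SMulCommClass T Uᵐᵒᵖ Q]
  (mc : MoritaContext U T P Q)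

/-- If `Q ⊗_U P → T` hits `1`, tensoring with `P` and then with `Q` is isomorphic to the
identity functor of the left `T`-modules. -/
noncomputable def evalIso (h : ∃ z, mc.qp z = 1) :
    BalTensor.functor T U P ⋙ BalTensor.functor U T Q ≅ 𝟭 (ModuleCat.{u} T) :=
  NatIso.ofComponents
    (fun X => (LinearEquiv.ofBijective (mc.eval X) (mc.eval_bijective h)).toModuleIso)
    (fun {X Y} f => ModuleCat.hom_ext (linearMap_ext fun q y => by
      change mc.eval Y (tmul U q (mapRight P U f.hom y)) = f.hom (mc.eval X (tmul U q y))
      induction y using BalTensor.induction_on with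
      | zero => simp [tmul_zero]
      | add y y' hy hy' => simp only [map_add, tmul_add, hy, hy']
      | tmul p x => exact (map_smul f.hom _ x).symm))

/-- A Morita context whose two maps hit `1` induces an equivalence of module categories. -/
noncomputable def equivalence (h₁ : ∃ x, mc.pq x = 1) (h₂ : ∃ z, mc.qp z = 1) :
    ModuleCat.{u} U ≌ ModuleCat.{u} T :=
  CategoryTheory.Equivalence.mk (BalTensor.functor U T Q) (BalTensor.functor T U P)
    (mc.symm.evalIso h₁).symm (mc.evalIso h₂)

theorem isMoritaEquivalent (h₁ : ∃ x, mc.pq x = 1) (h₂ : ∃ z, mc.qp z = 1) :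
    IsMoritaEquivalent ℤ U T :=
  ⟨⟨{ eqv := mc.equivalence h₁ h₂
      linear := (BalTensor.functor U T Q).linear_of_additive _ _ }⟩⟩

end

end MoritaContext

/-! ### The Morita context of a ring extension -/

namespace RingExt

variable {N : Type v} {M : Type u} [Ring N] [Ring M] {ι : N →+* M}

@[simp]
theorem coe_op_smul_B (r : R ι) (b : B ι) :
    ((op r • b : B ι) : TensorSq ι) = op (r : M) • b.1 := rfl

theorem evalHom_op_smul_A (α : A ι) (c : C ι) (t : TensorSq ι) :
    evalHom (op c • α) t = evalHom α (c.1 t) := evalHom_actC α c t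

theorem A_apply_eq_evalHom (α : A ι) (m : M) : α.1 m = evalHom α (tmul ι m 1) := by
  rw [evalHom_tmul, mul_one]

/-- Identities in `A` can thus be checked on the maps `α̂`, where the right action of `c ∈ C` is
plain precomposition. -/
theorem A_ext {α β : A ι} (h : ∀ t, evalHom α t = evalHom β t) : α = β :=
  Subtype.ext (AddMonoidHom.ext fun m =>
    (A_apply_eq_evalHom α m).trans ((h _).trans (A_apply_eq_evalHom β m).symm))

/-- The map `α̂` respects both the left `N`-action and the right `M`-action, so the relation `nb =
bn` is carried into `M`. -/
theorem evalHom_mem_R (α : A ι) (b : B ι) : evalHom α b.1 ∈ R ι := by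
  refine Subring.mem_centralizer_iff.2 ?_
  rintro _ ⟨n, rfl⟩
  rw [← evalHom_smul, b.2 n, evalHom_op_smul]

/-- The pairing `A × B → R`, `(α, b) ↦ α(b¹) b²`. -/
noncomputable def pair (α : A ι) (b : B ι) : R ι := ⟨evalHom α b.1, evalHom_mem_R α b⟩

@[simp]
theorem coe_pair (α : A ι) (b : B ι) : (pair α b : M) = evalHom α b.1 := rfl

theorem pair_add_left (α β : A ι) (b : B ι) : pair (α + β) b = pair α b + pair β b :=
  Subtype.ext (evalHom_add α β b.1)

theorem pair_add_right (α : A ι) (b b' : B ι) : pair α (b + b') = pair α b + pair α b' :=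
  Subtype.ext (map_add (evalHom α) b.1 b'.1)

theorem pair_smul_left (r : R ι) (α : A ι) (b : B ι) : pair (r • α) b = r * pair α b :=
  Subtype.ext (evalHom_rsmul r α b.1)

theorem pair_smul_right (r : R ι) (α : A ι) (b : B ι) : pair α (op r • b) = pair α b * r :=
  Subtype.ext (evalHom_op_smul α r b.1)

theorem pair_balanced (α : A ι) (c : C ι) (b : B ι) : pair (op c • α) b = pair α (c • b) :=
  Subtype.ext (evalHom_op_smul_A α c b.1)

/-- The endomorphism `t ↦ b α(t¹) t²` of `M ⊗_N M`. -/
noncomputable def rankOne (b : B ι) (α : A ι) : C ι :=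
  ⟨AddMonoidHom.mk' (fun t => op (evalHom α t) • b.1)
    (fun s t => by rw [map_add, op_add, add_smul]),
    fun n t => by
      change op (evalHom α (n • t)) • b.1 = n • op (evalHom α t) • b.1
      rw [evalHom_smul, op_mul, mul_smul, ← b.2 n, smul_comm n],
    fun m t => by
      change op (evalHom α (op m • t)) • b.1 = op m • op (evalHom α t) • b.1
      rw [evalHom_op_smul, op_mul, mul_smul]⟩

@[simp]
theorem rankOne_apply (b : B ι) (α : A ι) (t : TensorSq ι) :
    (rankOne b α).1 t = op (evalHom α t) • b.1 := rfl

theorem C_ext {c d : C ι} (h : ∀ t, c.1 t = d.1 t) : c = d :=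
  Subtype.ext (AddMonoidHom.ext h)

variable (ι) in
/-- The Morita context of the ring extension on `B` and `A`. -/
noncomputable def moritaContext : MoritaContext (C ι) (R ι) (B ι) (A ι) where
  pq := BalTensor.liftFun rankOne
    (fun b b' α => C_ext fun t => smul_add (op (evalHom α t)) b.1 b'.1)
    (fun b α β => C_ext fun t => by
      change op (evalHom (α + β) t) • b.1 = op (evalHom α t) • b.1 + op (evalHom β t) • b.1
      rw [evalHom_add, op_add, add_smul])
    (fun b r α => C_ext fun t => by
      change op (evalHom α t) • op (r : M) • b.1 = op (evalHom (r • α) t) • b.1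
      rw [evalHom_rsmul, op_mul, mul_smul])
  qp := BalTensor.liftFun pair pair_add_left pair_add_right pair_balanced
  pq_left c x := by
    induction x using BalTensor.induction_on with
    | zero => simp
    | add x y hx hy => rw [smul_add, map_add, map_add, hx, hy, mul_add]
    | tmul b α => exact C_ext fun t => (c.2.2 (evalHom α t) b.1).symm
  pq_right c x := by
    induction x using BalTensor.induction_on with
    | zero => simp
    | add x y hx hy => rw [smul_add, map_add, map_add, hx, hy, add_mul]
    | tmul b α =>
      exact C_ext fun t => congrArg (fun m => op m • b.1) (evalHom_op_smul_A α c t)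
  qp_left r x := by
    induction x using BalTensor.induction_on with
    | zero => simp
    | add x y hx hy => rw [smul_add, map_add, map_add, hx, hy, mul_add]
    | tmul α b => exact pair_smul_left r α b
  qp_right r x := by
    induction x using BalTensor.induction_on with
    | zero => simp
    | add x y hx hy => rw [smul_add, map_add, map_add, hx, hy, add_mul]
    | tmul α b => exact pair_smul_right r α b
  -- Both sides are `b α̂(b')` by definition.
  assoc_left _ _ _ := rfl
  assoc_right α b β := A_ext fun t => by
    change evalHom (pair α b • β) t = evalHom (op (rankOne b β) • α) t
    rw [evalHom_rsmul, evalHom_op_smul_A, rankOne_apply, evalHom_op_smul, coe_pair]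

theorem moritaContext_pq_tmul (b : B ι) (α : A ι) :
    (moritaContext ι).pq (BalTensor.tmul (R ι) b α) = rankOne b α := rfl

variable (ι) in
/-- The element `1 ⊗ 1` of `B`. -/
noncomputable def oneTmulOne : B ι :=
  ⟨tmul ι 1 1, fun n => by rw [smul_tmul, op_smul_tmul, mul_one, one_mul, ← one_mul (ι n),
    mul_tmul, one_mul, mul_one]⟩

theorem pair_oneTmulOne (α : A ι) : (pair α (oneTmulOne ι) : M) = α.1 1 :=
  (A_apply_eq_evalHom α 1).symm

theorem pair_one_oneTmulOne : pair (1 : A ι) (oneTmulOne ι) = 1 :=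
  Subtype.ext (pair_oneTmulOne 1)

/-- Depth two plays no role on this side of the context. -/
theorem exists_qp_eq_one : ∃ z, (moritaContext ι).qp z = 1 :=
  ⟨BalTensor.tmul (C ι) 1 (oneTmulOne ι), pair_one_oneTmulOne⟩

/-! ### Depth two quasibases -/

/-- The bimodule map `M → M` coming from the coordinates of an embedding of `M ⊗_N M`. -/
noncomputable def homOfTensorSq (f : TensorSq ι →+ M) (h₁ : ∀ (n : N) t, f (n • t) = ι n * f t)
    (h₂ : ∀ (m : M) t, f (op m • t) = f t * m) : A ι :=
  ⟨AddMonoidHom.mk' (fun m => f (tmul ι m 1)) (fun m m' => by rw [add_tmul, map_add]),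
    fun n m => by
      change f (tmul ι (ι n * m) 1) = ι n * f (tmul ι m 1) ∧
        f (tmul ι (m * ι n) 1) = f (tmul ι m 1) * ι n
      rw [tmul_one_smul, tmul_one_op_smul, h₁, h₂]
      exact ⟨rfl, rfl⟩⟩

theorem evalHom_homOfTensorSq (f : TensorSq ι →+ M) (h₁ : ∀ (n : N) t, f (n • t) = ι n * f t)
    (h₂ : ∀ (m : M) t, f (op m • t) = f t * m) (t : TensorSq ι) :
    evalHom (homOfTensorSq f h₁ h₂) t = f t := by
  induction t using induction_on with
  | zero => simp
  | tmul x y =>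
    rw [evalHom_tmul]
    change f (tmul ι x 1) * y = _
    rw [← h₂, op_smul_tmul, one_mul]
  | add s t hs ht => rw [map_add, map_add, hs, ht]

variable (ι) in
/-- A left depth two quasibasis: finitely many `β i ∈ A` and `b i ∈ B` such that
`x ⊗ y = ∑ i, b i · β i (x) y`. -/
structure Quasibasis (n : ℕ) where
  β : Fin n → A ι
  b : Fin n → B ι
  sum_eq : ∀ t : TensorSq ι, ∑ i, op (evalHom (β i) t) • (b i).1 = t

/-- The coordinates of the embedding into `Mⁿ` are bimodule maps to `M`, hence of the form `β̂ᵢ`.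
The projection back is determined by the images `bᵢ` of the standard vectors, which lie in `B`
because `ι(k)` commutes with the coordinates `0` and `1`. -/
theorem IsLeftD2.exists_quasibasis (h : IsLeftD2 ι) : ∃ n, Nonempty (Quasibasis ι n) := by
  obtain ⟨n, -, X, _, _, _, _, e, h₁, h₂⟩ := h
  have h₁' : ∀ (k : N) (v : Fin n → M), e.symm (fun i => ι k * v i) = k • e.symm v := fun k v =>
    e.injective (funext fun i => by rw [h₁, e.apply_symm_apply, e.apply_symm_apply])
  have h₂' : ∀ (m : M) (v : Fin n → M), e.symm (fun i => v i * m) = op m • e.symm v := fun m v =>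
    e.injective (funext fun i => by rw [h₂, e.apply_symm_apply, e.apply_symm_apply])
  let f (i : Fin n) : TensorSq ι →+ M :=
    (Pi.evalAddMonoidHom (fun _ => M) i).comp (e.toAddMonoidHom.comp (AddMonoidHom.inl _ _))
  have hf (i : Fin n) (t : TensorSq ι) : f i t = e (t, 0) i := rfl
  have hs (t : TensorSq ι) :
      ∑ i, op (f i t) • (e.symm (Pi.single i 1)).1 = t := by
    -- The vector `e (t, 0)` is expanded in the standard vectors; projecting to the first factor
    -- then discards the complement `X`.
    have : ∑ i, op (f i t) • e.symm (Pi.single i 1) = (t, 0) := by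
      refine e.injective (funext fun j => ?_)
      rw [map_sum, Finset.sum_apply]
      simp_rw [h₂, e.apply_symm_apply, Pi.single_apply, ite_mul, one_mul, zero_mul]
      simp [hf]
    simpa [Prod.fst_sum] using congrArg Prod.fst this
  refine ⟨n, ⟨⟨fun i => homOfTensorSq (f i) (fun k t => ?_) (fun m t => ?_),
    fun i => ⟨(e.symm (Pi.single i 1)).1, fun k => ?_⟩, fun t => ?_⟩⟩⟩
  · rw [hf, hf, ← h₁, Prod.smul_mk, smul_zero]
  · rw [hf, hf, ← h₂, Prod.smul_mk, smul_zero]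
  · rw [← Prod.smul_fst, ← Prod.smul_fst, ← h₁', ← h₂']
    congr 3
    funext j
    by_cases hj : j = i <;> simp [hj]
  · simp_rw [evalHom_homOfTensorSq]
    exact hs t

/-- The quasibasis identity reads `1 = ∑ rankOne (bᵢ) (βᵢ)` in `C`. -/
theorem exists_pq_eq_one {n : ℕ} (q : Quasibasis ι n) : ∃ x, (moritaContext ι).pq x = 1 := by
  refine ⟨∑ i, BalTensor.tmul (R ι) (q.b i) (q.β i), C_ext fun t => ?_⟩
  rw [map_sum]
  simp_rw [moritaContext_pq_tmul]
  rw [AddSubmonoidClass.coe_finsetSum]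
  exact (AddMonoidHom.finsetSum_apply _ _ t).trans (q.sum_eq t)

/-! ### Generator property, valid without depth two -/

section Generators

open CategoryTheory

/-- Every `x` in a right `R`-module is the image of `1 ⊗ 1` under the map `b ↦ x · pair 1 b`, so
maps that agree after composition with all maps from `B` agree at `x`. -/
theorem isSeparator_B : IsSeparator (ModuleCat.of (R ι)ᵐᵒᵖ (B ι)) := by
  refine (isSeparator_def _).2 fun X Y f g h => ModuleCat.hom_ext (LinearMap.ext fun x => ?_)
  let k : B ι →ₗ[(R ι)ᵐᵒᵖ] X :=
    { toFun := fun b => op (pair 1 b) • x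
      map_add' := fun b b' => by rw [pair_add_right, MulOpposite.op_add, add_smul]
      map_smul' := fun r b => by
        change op (pair 1 (op r.unop • b)) • x = r • op (pair 1 b) • x
        rw [pair_smul_right, op_mul, mul_smul, op_unop] }
  have hk : k (oneTmulOne ι) = x := by
    change op (pair 1 (oneTmulOne ι)) • x = x
    rw [pair_one_oneTmulOne, op_one, one_smul]
  have := congrArg (fun f => f.hom (oneTmulOne ι)) (h (ModuleCat.ofHom k))
  change f.hom (k (oneTmulOne ι)) = g.hom (k (oneTmulOne ι)) at this
  rwa [hk] at this

/-- The same argument with the map `α ↦ α(1) x`, which sends the identity of `M` to `x`. -/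
theorem isSeparator_A : IsSeparator (ModuleCat.of (R ι) (A ι)) := by
  refine (isSeparator_def _).2 fun X Y f g h => ModuleCat.hom_ext (LinearMap.ext fun x => ?_)
  let k : A ι →ₗ[R ι] X :=
    { toFun := fun α => pair α (oneTmulOne ι) • x
      map_add' := fun α β => by rw [pair_add_left, add_smul]
      map_smul' := fun r α => by rw [pair_smul_left, mul_smul, RingHom.id_apply] }
  have hk : k 1 = x := by
    change pair 1 (oneTmulOne ι) • x = x
    rw [pair_one_oneTmulOne, one_smul]
  have := congrArg (fun f => f.hom (1 : A ι)) (h (ModuleCat.ofHom k))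
  change f.hom (k 1) = g.hom (k 1) at this
  rwa [hk] at this

end Generators

/-! ### Dual bases and the explicit isomorphisms -/

/-- A module with a finite dual basis is finitely generated projective. -/
theorem finite_projective_of_dualBasis {T P : Type*} [Ring T] [AddCommGroup P] [Module T P]
    {n : ℕ} (f : Fin n → P →ₗ[T] T) (p : Fin n → P) (h : ∀ x, ∑ i, f i x • p i = x) :
    Module.Finite T P ∧ Module.Projective T P := by
  have H : (Fintype.linearCombination T p) ∘ₗ LinearMap.pi f = LinearMap.id :=
    LinearMap.ext fun x => (Fintype.linearCombination_apply T p _).trans (h x)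
  exact ⟨Module.Finite.of_surjective (Fintype.linearCombination T p)
    fun x => ⟨_, LinearMap.congr_fun H x⟩, Module.Projective.of_split _ _ H⟩

namespace Quasibasis

variable {n : ℕ} (q : Quasibasis ι n)

theorem sum_B (b : B ι) : ∑ i, op (pair (q.β i) b) • q.b i = b :=
  Subtype.ext (by rw [AddSubmonoidClass.coe_finsetSum]; exact q.sum_eq b.1)

/-- Applying `α̂` to `t = ∑ bᵢ β̂ᵢ(t)` and using right `M`-linearity gives `α̂(t) = ∑ α̂(bᵢ)
β̂ᵢ(t)`. So the roles of `bᵢ` and `βᵢ`, as basis and coordinates, are exchanged. -/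
theorem sum_A (α : A ι) : ∑ i, pair α (q.b i) • q.β i = α := A_ext fun t => by
  have key : ∀ s : Finset (Fin n), evalHom (∑ i ∈ s, pair α (q.b i) • q.β i) t =
      ∑ i ∈ s, evalHom α (q.b i).1 * evalHom (q.β i) t := fun s => by
    classical
    induction s using Finset.induction_on with
    | empty => exact evalHom_zero t
    | insert i s hi hs =>
      rw [Finset.sum_insert hi, Finset.sum_insert hi, evalHom_add, hs, evalHom_rsmul, coe_pair]
  rw [key]
  conv_rhs => rw [← q.sum_eq t, map_sum]
  simp_rw [evalHom_op_smul]

theorem isFGProjGenerator_B {n : ℕ} (q : Quasibasis ι n) :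
    IsFGProjGenerator (R ι)ᵐᵒᵖ (B ι) := by
  have h := finite_projective_of_dualBasis (T := (R ι)ᵐᵒᵖ) (fun i =>
    { toFun := fun b => op (pair (q.β i) b)
      map_add' := fun b b' => by rw [pair_add_right, op_add]
      map_smul' := fun r b => by
        change op (pair (q.β i) (op r.unop • b)) = r * op (pair (q.β i) b)
        rw [pair_smul_right, op_mul, op_unop] }) q.b q.sum_B
  exact ⟨h.1, h.2, isSeparator_B⟩

theorem isFGProjGenerator_A {n : ℕ} (q : Quasibasis ι n) :
    IsFGProjGenerator (R ι) (A ι) := by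
  have h := finite_projective_of_dualBasis (T := R ι) (fun i =>
    { toFun := fun α => pair α (q.b i)
      map_add' := fun α β => pair_add_left α β _
      map_smul' := fun r α => pair_smul_left r α _ }) q.β q.sum_A
  exact ⟨h.1, h.2, isSeparator_A⟩

/-- The isomorphism `B ≃ Hom(_R A, _R R)`, `b ↦ (α ↦ α(b¹) b²)`. -/
noncomputable def psi : B ι ≃ₗ[(R ι)ᵐᵒᵖ] (A ι →ₗ[R ι] R ι) where
  toFun b :=
    { toFun := fun α => pair α b
      map_add' := fun α β => pair_add_left α β b
      map_smul' := fun r α => pair_smul_left r α b }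
  map_add' b b' := LinearMap.ext fun α => pair_add_right α b b'
  map_smul' r b := LinearMap.ext fun α => pair_smul_right r.unop α b
  -- By `sum_A`, `f` is determined by its values on the `βᵢ`; these serve as the coordinates of the
  -- preimage.
  invFun f := ∑ i, op (f (q.β i)) • q.b i
  left_inv b := q.sum_B b
  right_inv f := LinearMap.ext fun α => by
    change pair α (∑ i, op (f (q.β i)) • q.b i) = f α
    have : ∀ b, pair α b = AddMonoidHom.mk' (pair α) (pair_add_right α) b := fun _ => rfl
    rw [this, map_sum]
    simp_rw [← this, pair_smul_right]
    conv_rhs => rw [← q.sum_A α, map_sum]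
    simp_rw [map_smul, smul_eq_mul]

/-- The isomorphism `B ⊗_R M ≃ M ⊗_N M`, `b ⊗ m ↦ b m`. -/
noncomputable def tau : BalTensor (R ι) (B ι) M ≃+ TensorSq ι where
  __ := BalTensor.liftFun (S := R ι) (fun (b : B ι) (m : M) => op m • b.1)
    (fun b b' m => smul_add (op m) b.1 b'.1) (fun b m m' => by rw [op_add, add_smul])
    (fun b r m => by
      rw [coe_op_smul_B, Subring.smul_def, smul_eq_mul, op_mul, mul_smul])
  invFun t := ∑ i, BalTensor.tmul (R ι) (q.b i) (evalHom (q.β i) t)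
  left_inv x := by
    change ∑ i, BalTensor.tmul (R ι) (q.b i) (evalHom (q.β i) (BalTensor.liftFun _ _ _ _ x)) = x
    induction x using BalTensor.induction_on with
    | zero => simp [BalTensor.tmul_zero]
    | add x y hx hy =>
      simp_rw [map_add, BalTensor.tmul_add]
      rw [Finset.sum_add_distrib, hx, hy]
    | tmul b m =>
      conv_rhs => rw [← q.sum_B b]
      have : ∀ b : B ι, BalTensor.tmul (R ι) b m = BalTensor.tmulRight (B ι) (C ι) m b :=
        fun _ => rfl
      rw [this (∑ i, _), map_sum]
      -- Termwise, `β̂ᵢ(bm) = β̂ᵢ(b) m` with `β̂ᵢ(b) ∈ R`, and this scalar moves across the tensor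
      -- sign.
      refine Finset.sum_congr rfl fun i _ => ?_
      rw [← this, BalTensor.smul_tmul, BalTensor.liftFun_tmul, evalHom_op_smul]
      rfl
  right_inv t := by
    change BalTensor.liftFun _ _ _ _ (∑ i, BalTensor.tmul (R ι) (q.b i) _) = t
    rw [map_sum]
    exact q.sum_eq t

/-- The isomorphism `M ⊗_N M ≃ Hom(_R A, _R M)`, `m ⊗ m' ↦ (α ↦ α(m) m')`. -/
noncomputable def homEquiv : TensorSq ι ≃+ (A ι →ₗ[R ι] M) where
  toFun t :=
    { toFun := fun α => evalHom α t
      map_add' := fun α β => evalHom_add α β t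
      map_smul' := fun r α => evalHom_rsmul r α t }
  map_add' s t := LinearMap.ext fun α => map_add (evalHom α) s t
  invFun f := ∑ i, op (f (q.β i)) • (q.b i).1
  left_inv t := q.sum_eq t
  right_inv f := LinearMap.ext fun α => by
    change evalHom α (∑ i, op (f (q.β i)) • (q.b i).1) = f α
    rw [map_sum]
    simp_rw [evalHom_op_smul]
    conv_rhs => rw [← q.sum_A α, map_sum]
    simp_rw [map_smul, Subring.smul_def, coe_pair, smul_eq_mul]

/-- The `bᵢ` generate `M ⊗_N M` as a right `M`-module, so an element of `C` is determined by its
action on `B`. -/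
theorem C_apply (c : C ι) (t : TensorSq ι) :
    c.1 t = ∑ i, op (evalHom (q.β i) t) • (c • q.b i).1 := by
  conv_lhs => rw [← q.sum_eq t]
  refine (map_sum c.1 _ _).trans (Finset.sum_congr rfl fun i _ => c.2.2 _ _)

/-- The ring isomorphism `C ≃ End(B_R)`. -/
noncomputable def endB : C ι ≃+* Module.End (R ι)ᵐᵒᵖ (B ι) :=
  RingEquiv.ofBijective (Module.toModuleEnd (R ι)ᵐᵒᵖ (S := C ι) (B ι)) (by
    -- The preimage of `g` comes from `g(b) = ∑ g(bᵢ) · pair (βᵢ) b`, a sum of rank-one actions.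
    refine ⟨fun c d h => C_ext fun t => ?_, fun g => ⟨∑ i, rankOne (g (q.b i)) (q.β i), ?_⟩⟩
    · rw [q.C_apply c, q.C_apply d]
      refine Finset.sum_congr rfl fun i _ => ?_
      exact congrArg (fun b : B ι => op (evalHom (q.β i) t) • b.1) (LinearMap.congr_fun h (q.b i))
    · refine LinearMap.ext fun b => ?_
      change (∑ i, rankOne (g (q.b i)) (q.β i)) • b = g b
      rw [Finset.sum_smul]
      conv_rhs => rw [← q.sum_B b, map_sum]
      simp_rw [map_smul]
      rfl)

/-- The ring isomorphism `C ≃ End(_R A)`, where endomorphisms act from the right. -/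
noncomputable def endA : C ι ≃+* (Module.End (R ι) (A ι))ᵐᵒᵖ :=
  haveI : SMulCommClass (C ι)ᵐᵒᵖ (R ι) (A ι) := SMulCommClass.symm _ _ _
  RingEquiv.ofBijective
    -- The right action is a ring map `Cᵐᵒᵖ → End(_R A)`; its opposite is precomposed with `C ≅
    -- Cᵐᵒᵖᵐᵒᵖ`.
    ((Module.toModuleEnd (R ι) (S := (C ι)ᵐᵒᵖ) (A ι)).op.comp
      (RingEquiv.opOp (C ι)).toRingHom) (by
    -- The preimage of `g` comes from `g(α) = ∑ pair α (bᵢ) · g(βᵢ)`, whose terms are `α · rankOne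
    -- (bᵢ) (g(βᵢ))` by the second associativity law.
    refine ⟨fun c d h => C_ext fun t => ?_, fun g =>
      ⟨∑ i, rankOne (q.b i) (g.unop (q.β i)), unop_injective (LinearMap.ext fun α => ?_)⟩⟩
    · have h' : ∀ α : A ι, op c • α = op d • α := LinearMap.congr_fun (congrArg unop h)
      -- The coordinates of `c(t)` are `β̂ᵢ(c(t))`, the values at `t` of the map attached to `βᵢ ·
      -- c`; they depend only on the action of `c` on `A`.
      rw [← q.sum_eq (c.1 t), ← q.sum_eq (d.1 t)]
      simp_rw [← evalHom_op_smul_A, h']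
    · change op (∑ i, rankOne (q.b i) (g.unop (q.β i))) • α = g.unop α
      rw [Finset.op_sum, Finset.sum_smul]
      conv_rhs => rw [← q.sum_A α, map_sum]
      simp_rw [map_smul]
      exact Finset.sum_congr rfl fun i _ => ((moritaContext ι).assoc_right _ _ _).symm)

end Quasibasis

end RingExt

/-! ### The main theorem -/

theorem mainTheorem1 {N : Type v} {M : Type u} [Ring N] [Ring M] (ι : N →+* M)
    (hD2 : RingExt.IsLeftD2 ι) :
    -- `C` and `R` are Morita equivalent
    IsMoritaEquivalent ℤ (RingExt.C ι) (RingExt.R ι) ∧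
    -- a Morita context on `B` and `A` with both maps bijective; its first map is `μ_R` of (1)
    (∃ mc : MoritaContext (RingExt.C ι) (RingExt.R ι) (RingExt.B ι) (RingExt.A ι),
      Function.Bijective mc.pq ∧ Function.Bijective mc.qp ∧
      (∀ (b : RingExt.B ι) (α : RingExt.A ι) (m m' : M),
        (mc.pq (BalTensor.tmul (RingExt.R ι) b α)).1 (RingExt.tmul ι m m') =
          op (α.1 m * m') • b.1) ∧
      (∀ (α : RingExt.A ι) (b : RingExt.B ι),
        (mc.qp (BalTensor.tmul (RingExt.C ι) α b) : M) = RingExt.evalHom α b.1)) ∧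
    -- `B_R` and `_R A` are f.g. projective generators
    IsFGProjGenerator (RingExt.R ι)ᵐᵒᵖ (RingExt.B ι) ∧
    IsFGProjGenerator (RingExt.R ι) (RingExt.A ι) ∧
    -- (2) `ψ`, an isomorphism of `C`-`R`-bimodules
    (∃ ψ : RingExt.B ι ≃ₗ[(RingExt.R ι)ᵐᵒᵖ] (RingExt.A ι →ₗ[RingExt.R ι] RingExt.R ι),
      (∀ b α, (ψ b α : M) = RingExt.evalHom α b.1) ∧
      (∀ (c : RingExt.C ι) b α, ψ (c • b) α = ψ b (op c • α))) ∧
    -- (3) `τ`, an isomorphism of `C`-`M`-bimodules, also compatible with the left `N`-actions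
    (∃ τ : BalTensor (RingExt.R ι) (RingExt.B ι) M ≃+ RingExt.TensorSq ι,
      (∀ (b : RingExt.B ι) (m : M), τ (BalTensor.tmul (RingExt.R ι) b m) = op m • b.1) ∧
      (∀ (c : RingExt.C ι) x, τ (c • x) = c.1 (τ x)) ∧
      (∀ (m : M) x, τ (op m • x) = op m • τ x) ∧
      (∀ (n : N) (b : RingExt.B ι) (m : M),
        τ (BalTensor.tmul (RingExt.R ι) b (ι n * m)) =
          n • τ (BalTensor.tmul (RingExt.R ι) b m))) ∧
    -- (4) `M ⊗_N M ≅ Hom(_R A, _R M)`, compatible with the `C`-, `N`- and `M`-actions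
    (∃ j : RingExt.TensorSq ι ≃+ (RingExt.A ι →ₗ[RingExt.R ι] M),
      (∀ (m m' : M) (α : RingExt.A ι), j (RingExt.tmul ι m m') α = α.1 m * m') ∧
      (∀ (c : RingExt.C ι) t α, j (c.1 t) α = j t (op c • α)) ∧
      (∀ (n : N) t α, j (n • t) α = ι n * j t α) ∧
      (∀ (m : M) t α, j (op m • t) α = j t α * m)) ∧
    -- (5) `C ≅ End B_R` as rings
    (∃ e : RingExt.C ι ≃+* Module.End (RingExt.R ι)ᵐᵒᵖ (RingExt.B ι),
      ∀ c b, (e c b).1 = c.1 b.1) ∧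
    -- (6) `C ≅ End _R A` as rings, endomorphisms of the left module `A` acting from the right
    (∃ e : RingExt.C ι ≃+* (Module.End (RingExt.R ι) (RingExt.A ι))ᵐᵒᵖ,
      ∀ c α m, ((e c).unop α).1 m = RingExt.evalHom α (c.1 (RingExt.tmul ι m 1))) := by
  obtain ⟨n, ⟨q⟩⟩ := hD2.exists_quasibasis
  let mc := RingExt.moritaContext ι
  have h₁ : ∃ x, mc.pq x = 1 := RingExt.exists_pq_eq_one q
  have h₂ : ∃ z, mc.qp z = 1 := RingExt.exists_qp_eq_one
  refine ⟨mc.isMoritaEquivalent h₁ h₂,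
    ⟨mc, mc.pq_bijective (mc.pq_surjective h₁), mc.symm.pq_bijective (mc.symm.pq_surjective h₂),
      fun _ _ _ _ => rfl, fun _ _ => rfl⟩,
    q.isFGProjGenerator_B, q.isFGProjGenerator_A,
    ⟨q.psi, fun _ _ => rfl, fun c b α => (RingExt.pair_balanced α c b).symm⟩,
    ⟨q.tau, fun _ _ => rfl, fun c x => ?_, fun m x => ?_, fun k b m => ?_⟩,
    ⟨q.homEquiv, fun _ _ _ => rfl, fun c t α => (RingExt.evalHom_op_smul_A α c t).symm,
      fun k t α => RingExt.evalHom_smul α k t, fun m t α => RingExt.evalHom_op_smul α m t⟩,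
    ⟨q.endB, fun _ _ => rfl⟩, ⟨q.endA, fun _ _ _ => rfl⟩⟩
  · induction x using BalTensor.induction_on with
    | zero => rw [smul_zero, map_zero]; exact (map_zero c.1).symm
    | add x y hx hy => rw [smul_add, map_add, map_add, hx, hy]; exact (map_add c.1 _ _).symm
    | tmul b m => exact (c.2.2 m b.1).symm
  · induction x using BalTensor.induction_on with
    | zero => simp
    | add x y hx hy => rw [smul_add, map_add, map_add, hx, hy, smul_add]
    | tmul b m' => exact (congrArg (· • b.1) (op_mul m' m)).trans (mul_smul (op m) (op m') b.1)
  · change op (ι k * m) • b.1 = k • op m • b.1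
    -- Since `b ∈ B`, right multiplication of `b` by `ι k` equals the left action of `k`, which
    -- commutes with right multiplication by `m`.
    rw [op_mul, mul_smul, ← b.2 k, smul_comm k]
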